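/- Let $\mathbb{D}$ be the open unit disc in $\mathbb{C}$. The Bloch space $\mathcal{B}$ consists of all analytic functions $f:\mathbb{D}\to\mathbb{C}$ with $\sup_{z\in\mathbb{D}}(1-|z|^2)|f'(z)|<\infty$; it is a Banach space under the norm $$\|f\|_{\mathcal{B}}=|f(0)|+\sup_{z\in\mathbb{D}}(1-|z|^2)|f'(z)|.$$ An analytic self-map $\varphi:\mathbb{D}\to\mathbb{D}$ induces the composition operator $C_\varphi f=f\circ\varphi$, which maps $\mathcal{B}$ into itself. Let $k$ be a positive integer, let $\lambda_1,\dots,\lambda_k$ be nonzero complex scalars, and let $\varphi_1,\dots,\varphi_k$ be analytic self-maps of $\mathbb{D}$. Then the operator $\sum_{i=1}^k\lambda_iC_{\varphi_i}$ is compact on $\mathcal{B}$ if and only if $$\lim_{n\to\infty}\|\lambda_1\varphi_1^n+\lambda_2\varphi_2^n+\cdots+\lambda_k\varphi_k^n\|_{\mathcal{B}}=0,$$ where $\varphi_i^n$ denotes the pointwise $n$-th power, $\varphi_i^n(z)=(\varphi_i(z))^n$. -/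

import Mathlib

open Filter Topology
open scoped Complex.UnitDisc ComplexConjugate

noncomputable section

/-- The extension by zero to `ℂ` of a function on the open unit disc. Only its restriction to the
(open) disc matters below. -/
def discExt (f : 𝔻 → ℂ) : ℂ → ℂ :=
  Function.extend (fun z : 𝔻 => (z : ℂ)) f (fun _ => 0)

/-- `f ∈ H(𝔻)`: the function `f` is analytic (holomorphic) on the open unit disc. -/
def AnalyticOnDisc (f : 𝔻 → ℂ) : Prop :=
  DifferentiableOn ℂ (discExt f) (Metric.ball 0 1)

/-- `φ` is an analytic self-map of the open unit disc. -/
def IsAnalyticSelfMap (φ : 𝔻 → 𝔻) : Prop :=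
  AnalyticOnDisc fun z => (φ z : ℂ)

/-- The complex derivative of a function on the open unit disc. -/
def discDeriv (f : 𝔻 → ℂ) (z : 𝔻) : ℂ :=
  deriv (discExt f) (z : ℂ)

/-- The quantity `(1 - |z|²) |f'(z)|`. -/
def blochDensity (f : 𝔻 → ℂ) (z : 𝔻) : ℝ :=
  (1 - ‖(z : ℂ)‖ ^ 2) * ‖discDeriv f z‖

/-- Membership in the Bloch space: `f` is analytic on the disc and
`sup_{z ∈ 𝔻} (1 - |z|²) |f'(z)| < ∞`. -/
def IsBloch (f : 𝔻 → ℂ) : Prop :=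
  AnalyticOnDisc f ∧ BddAbove (Set.range (blochDensity f))

/-! ### Elementary facts on functions on the disc -/

theorem coe_mem_ball (z : 𝔻) : (z : ℂ) ∈ Metric.ball (0 : ℂ) 1 :=
  mem_ball_zero_iff.2 z.norm_lt_one

theorem discExt_coe (f : 𝔻 → ℂ) (z : 𝔻) : discExt f (z : ℂ) = f z :=
  Complex.UnitDisc.coe_injective.extend_apply f _ z

/-- Analyticity on the disc can be checked on any function on `ℂ` that agrees with `f` there. -/
theorem discExt_eqOn {f : 𝔻 → ℂ} {g : ℂ → ℂ} (h : ∀ z : 𝔻, f z = g z) :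
    Set.EqOn (discExt f) g (Metric.ball 0 1) := by
  intro z hz
  have := discExt_coe f (Complex.UnitDisc.mk z (mem_ball_zero_iff.1 hz))
  rw [h] at this
  simpa using this

theorem analyticOnDisc_of_eq {f : 𝔻 → ℂ} {g : ℂ → ℂ} (h : ∀ z : 𝔻, f z = g z)
    (hg : DifferentiableOn ℂ g (Metric.ball 0 1)) : AnalyticOnDisc f :=
  hg.congr (discExt_eqOn h)

theorem discDeriv_of_eq {f : 𝔻 → ℂ} {g : ℂ → ℂ} (h : ∀ z : 𝔻, f z = g z) (z : 𝔻) :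
    discDeriv f z = deriv g z :=
  ((discExt_eqOn h).eventuallyEq_of_mem (Metric.isOpen_ball.mem_nhds (coe_mem_ball z))).deriv_eq

theorem AnalyticOnDisc.differentiableAt {f : 𝔻 → ℂ} (hf : AnalyticOnDisc f) (z : 𝔻) :
    DifferentiableAt ℂ (discExt f) (z : ℂ) :=
  DifferentiableOn.differentiableAt hf (Metric.isOpen_ball.mem_nhds (coe_mem_ball z))

theorem one_sub_norm_sq_pos (z : 𝔻) : 0 < 1 - ‖(z : ℂ)‖ ^ 2 :=
  sub_pos.2 z.sq_norm_lt_one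

theorem blochDensity_nonneg (f : 𝔻 → ℂ) (z : 𝔻) : 0 ≤ blochDensity f z :=
  mul_nonneg (one_sub_norm_sq_pos z).le (norm_nonneg _)

theorem AnalyticOnDisc.add {f g : 𝔻 → ℂ} (hf : AnalyticOnDisc f) (hg : AnalyticOnDisc g) :
    AnalyticOnDisc (f + g) :=
  analyticOnDisc_of_eq (g := discExt f + discExt g) (fun z => by simp [discExt_coe])
    (DifferentiableOn.add hf hg)

theorem AnalyticOnDisc.smul {f : 𝔻 → ℂ} (c : ℂ) (hf : AnalyticOnDisc f) :
    AnalyticOnDisc (c • f) :=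
  analyticOnDisc_of_eq (g := c • discExt f) (fun z => by simp [discExt_coe])
    (DifferentiableOn.const_smul hf c)

theorem discDeriv_add {f g : 𝔻 → ℂ} (hf : AnalyticOnDisc f) (hg : AnalyticOnDisc g) (z : 𝔻) :
    discDeriv (f + g) z = discDeriv f z + discDeriv g z := by
  rw [discDeriv_of_eq (g := discExt f + discExt g) (fun z => by simp [discExt_coe])]
  exact deriv_add (hf.differentiableAt z) (hg.differentiableAt z)

theorem discDeriv_smul {f : 𝔻 → ℂ} (c : ℂ) (hf : AnalyticOnDisc f) (z : 𝔻) :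
    discDeriv (c • f) z = c * discDeriv f z := by
  rw [discDeriv_of_eq (g := c • discExt f) (fun z => by simp [discExt_coe])]
  exact deriv_const_smul c (hf.differentiableAt z)

theorem blochDensity_add_le {f g : 𝔻 → ℂ} (hf : AnalyticOnDisc f) (hg : AnalyticOnDisc g)
    (z : 𝔻) : blochDensity (f + g) z ≤ blochDensity f z + blochDensity g z := by
  simp only [blochDensity, discDeriv_add hf hg, ← mul_add]
  exact mul_le_mul_of_nonneg_left (norm_add_le _ _) (one_sub_norm_sq_pos z).le

theorem blochDensity_smul {f : 𝔻 → ℂ} (c : ℂ) (hf : AnalyticOnDisc f) (z : 𝔻) :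
    blochDensity (c • f) z = ‖c‖ * blochDensity f z := by
  simp only [blochDensity, discDeriv_smul c hf, norm_mul]
  ring

theorem IsBloch.zero : IsBloch 0 := by
  refine ⟨analyticOnDisc_of_eq (g := fun _ => 0) (fun _ => rfl) (differentiableOn_const 0), 0, ?_⟩
  rintro _ ⟨z, rfl⟩
  simp [blochDensity, discDeriv_of_eq (f := 0) (g := fun _ => (0 : ℂ)) (fun _ => rfl)]

theorem IsBloch.add {f g : 𝔻 → ℂ} (hf : IsBloch f) (hg : IsBloch g) : IsBloch (f + g) := by
  obtain ⟨hf, A, hA⟩ := hf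
  obtain ⟨hg, B, hB⟩ := hg
  refine ⟨hf.add hg, A + B, ?_⟩
  rintro _ ⟨z, rfl⟩
  exact (blochDensity_add_le hf hg z).trans (add_le_add (hA ⟨z, rfl⟩) (hB ⟨z, rfl⟩))

theorem IsBloch.smul {f : 𝔻 → ℂ} (c : ℂ) (hf : IsBloch f) : IsBloch (c • f) := by
  obtain ⟨hf, A, hA⟩ := hf
  refine ⟨hf.smul c, ‖c‖ * A, ?_⟩
  rintro _ ⟨z, rfl⟩
  rw [blochDensity_smul c hf]
  exact mul_le_mul_of_nonneg_left (hA ⟨z, rfl⟩) (norm_nonneg c)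

/-! ### The Bloch space as a normed space -/

/-- The Bloch functions, as a vector subspace of all functions on the disc. -/
def blochSubmodule : Submodule ℂ (𝔻 → ℂ) where
  carrier := {f | IsBloch f}
  add_mem' := IsBloch.add
  zero_mem' := IsBloch.zero
  smul_mem' := fun c _ hf => hf.smul c

/-- The Bloch space `𝓑`, with pointwise vector space structure. It is a type of its own, so that
its topology is that of the Bloch norm and not that of pointwise convergence. -/
def BlochSpace : Type := blochSubmodule

namespace BlochSpace

instance : AddCommGroup BlochSpace := inferInstanceAs (AddCommGroup blochSubmodule)

instance : Module ℂ BlochSpace := inferInstanceAs (Module ℂ blochSubmodule)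

/-- The element of the Bloch space given by a Bloch function. -/
def mk (f : 𝔻 → ℂ) (hf : IsBloch f) : BlochSpace := ⟨f, hf⟩

/-- The function on the disc underlying an element of the Bloch space. -/
def toFun (f : BlochSpace) : 𝔻 → ℂ := f.1

instance : CoeFun BlochSpace (fun _ => 𝔻 → ℂ) := ⟨toFun⟩

theorem isBloch (f : BlochSpace) : IsBloch f := f.2

theorem ext {f g : BlochSpace} (h : ∀ z, f z = g z) : f = g := Subtype.ext (funext h)

theorem mk_apply (f : 𝔻 → ℂ) (hf : IsBloch f) (z : 𝔻) : mk f hf z = f z := rfl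

theorem toFun_zero : toFun 0 = 0 := rfl

theorem toFun_add (f g : BlochSpace) : toFun (f + g) = toFun f + toFun g := rfl

theorem toFun_smul (c : ℂ) (f : BlochSpace) : toFun (c • f) = c • toFun f := rfl

/-- The Bloch seminorm `‖f‖_β = sup_{z ∈ 𝔻} (1 - |z|²) |f'(z)|`. -/
def seminorm (f : BlochSpace) : ℝ := ⨆ z : 𝔻, blochDensity f z

/-- The Bloch norm `‖f‖_𝓑 = |f(0)| + ‖f‖_β`. -/
instance : Norm BlochSpace := ⟨fun f => ‖f 0‖ + f.seminorm⟩

theorem norm_def (f : BlochSpace) : ‖f‖ = ‖f 0‖ + ⨆ z : 𝔻, blochDensity f z := rfl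

theorem blochDensity_le (f : BlochSpace) (z : 𝔻) : blochDensity f z ≤ f.seminorm :=
  le_ciSup f.isBloch.2 z

theorem seminorm_nonneg (f : BlochSpace) : 0 ≤ f.seminorm :=
  Real.iSup_nonneg (blochDensity_nonneg f)

theorem eq_zero_of_norm_eq_zero (f : BlochSpace) (h : ‖f‖ = 0) : f = 0 := by
  have h' : ‖f 0‖ + f.seminorm = 0 := h
  have h0 : f 0 = 0 := norm_eq_zero.1 (by linarith [norm_nonneg (f 0), f.seminorm_nonneg])
  have hs : f.seminorm = 0 := by linarith [norm_nonneg (f 0), f.seminorm_nonneg]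
  have hd : ∀ z : 𝔻, discDeriv f z = 0 := by
    intro z
    have h1 : blochDensity f z ≤ 0 := hs ▸ f.blochDensity_le z
    have h2 : ‖discDeriv f z‖ ≤ 0 :=
      nonpos_of_mul_nonpos_right h1 (one_sub_norm_sq_pos z)
    exact norm_le_zero_iff.1 h2
  refine ext fun z => ?_
  have key := Metric.isOpen_ball.is_const_of_deriv_eq_zero
    (convex_ball (0 : ℂ) 1).isPreconnected (f := discExt f) f.isBloch.1
    (fun w hw => hd (Complex.UnitDisc.mk w (mem_ball_zero_iff.1 hw)))
    (coe_mem_ball z) (coe_mem_ball 0)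
  rw [discExt_coe, discExt_coe, h0] at key
  rw [key]
  rfl

theorem normedSpaceCore : NormedSpace.Core ℂ BlochSpace where
  norm_nonneg f := add_nonneg (norm_nonneg _) f.seminorm_nonneg
  norm_smul c f := by
    have h : ∀ z, blochDensity (c • f : BlochSpace) z = ‖c‖ * blochDensity f z :=
      blochDensity_smul c f.isBloch.1
    rw [norm_def, norm_def, mul_add, Real.mul_iSup_of_nonneg (norm_nonneg c)]
    simp only [h]
    rw [toFun_smul, Pi.smul_apply, norm_smul]
  norm_triangle f g := by
    have h : (f + g).seminorm ≤ f.seminorm + g.seminorm :=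
      ciSup_le fun z => (blochDensity_add_le f.isBloch.1 g.isBloch.1 z).trans
        (add_le_add (f.blochDensity_le z) (g.blochDensity_le z))
    have h0 : ‖(f + g) 0‖ ≤ ‖f 0‖ + ‖g 0‖ := norm_add_le (f 0) (g 0)
    change ‖(f + g) 0‖ + (f + g).seminorm ≤ (‖f 0‖ + f.seminorm) + (‖g 0‖ + g.seminorm)
    linarith
  norm_eq_zero_iff f := by
    refine ⟨f.eq_zero_of_norm_eq_zero, ?_⟩
    rintro rfl
    have h : ∀ z, blochDensity (0 : BlochSpace) z = 0 := fun z => by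
      simp [toFun_zero, blochDensity,
        discDeriv_of_eq (f := 0) (g := fun _ => (0 : ℂ)) (fun _ => rfl)]
    rw [norm_def]
    simp only [h]
    simp [toFun_zero]

instance : NormedAddCommGroup BlochSpace := NormedAddCommGroup.ofCore normedSpaceCore

instance : NormedSpace ℂ BlochSpace := NormedSpace.ofCore normedSpaceCore

end BlochSpace

/-! ### The Schwarz–Pick inequality, and composition operators on the Bloch space -/

theorem moebius_denom_ne_zero {a w : ℂ} (ha : ‖a‖ < 1) (hw : ‖w‖ < 1) : 1 + conj a * w ≠ 0 := by
  intro h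
  have h1 : ‖conj a * w‖ = 1 := by
    rw [← neg_eq_of_add_eq_zero_right h]
    simp
  rw [norm_mul, Complex.norm_conj] at h1
  nlinarith [norm_nonneg a, norm_nonneg w]

theorem hasDerivAt_moebius {a w : ℂ} (h : 1 + conj a * w ≠ 0) :
    HasDerivAt (fun u => (u + a) / (1 + conj a * u))
      ((1 - a * conj a) / (1 + conj a * w) ^ 2) w := by
  have h1 : HasDerivAt (fun u => u + a) 1 w := (hasDerivAt_id w).add_const a
  have h2 : HasDerivAt (fun u => 1 + conj a * u) (conj a) w := by
    simpa using ((hasDerivAt_id w).const_mul (conj a)).const_add 1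
  refine (h1.div h2 h).congr_deriv ?_
  congr 1
  ring

theorem norm_moebius_lt_one {a w : ℂ} (ha : ‖a‖ < 1) (hw : ‖w‖ < 1) :
    ‖(w + a) / (1 + conj a * w)‖ < 1 := by
  have hne := norm_pos_iff.2 (moebius_denom_ne_zero ha hw)
  rw [norm_div, div_lt_one hne]
  refine lt_of_pow_lt_pow_left₀ 2 hne.le ?_
  have ha' : 0 < 1 - ‖a‖ ^ 2 := by nlinarith [norm_nonneg a]
  have hw' : 0 < 1 - ‖w‖ ^ 2 := by nlinarith [norm_nonneg w]
  have key := mul_pos ha' hw'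
  simp only [Complex.sq_norm, Complex.normSq_apply, Complex.add_re, Complex.add_im,
    Complex.mul_re, Complex.mul_im, Complex.conj_re, Complex.conj_im, Complex.one_re,
    Complex.one_im] at key ⊢
  nlinarith [key]

theorem one_sub_mul_conj (a : ℂ) : 1 - a * conj a = ((1 - ‖a‖ ^ 2 : ℝ) : ℂ) := by
  rw [Complex.mul_conj, Complex.normSq_eq_norm_sq]
  push_cast
  rfl

/-- The Schwarz–Pick inequality `(1 - |z|²) |F'(z)| ≤ 1 - |F(z)|²`. -/
theorem schwarzPick {F : ℂ → ℂ} (hF : DifferentiableOn ℂ F (Metric.ball 0 1))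
    (hm : Set.MapsTo F (Metric.ball 0 1) (Metric.ball 0 1)) {z : ℂ} (hz : ‖z‖ < 1) :
    (1 - ‖z‖ ^ 2) * ‖deriv F z‖ ≤ 1 - ‖F z‖ ^ 2 := by
  have hb : ‖F z‖ < 1 := mem_ball_zero_iff.1 (hm (mem_ball_zero_iff.2 hz))
  have hz' : 0 < 1 - ‖z‖ ^ 2 := by nlinarith [norm_nonneg z]
  have hb' : 0 < 1 - ‖F z‖ ^ 2 := by nlinarith [norm_nonneg (F z)]
  set b := F z with hbdef
  let T : ℂ → ℂ := fun u => (u + z) / (1 + conj z * u)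
  let S : ℂ → ℂ := fun u => (u + -b) / (1 + conj (-b) * u)
  have hnb : ‖-b‖ < 1 := by rwa [norm_neg]
  have hTm : Set.MapsTo T (Metric.ball 0 1) (Metric.ball 0 1) := fun w hw =>
    mem_ball_zero_iff.2 (norm_moebius_lt_one hz (mem_ball_zero_iff.1 hw))
  have hSm : Set.MapsTo S (Metric.ball 0 1) (Metric.ball 0 1) := fun w hw =>
    mem_ball_zero_iff.2 (norm_moebius_lt_one hnb (mem_ball_zero_iff.1 hw))
  have hTd : DifferentiableOn ℂ T (Metric.ball 0 1) := fun w hw =>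
    (hasDerivAt_moebius (moebius_denom_ne_zero hz
      (mem_ball_zero_iff.1 hw))).differentiableAt.differentiableWithinAt
  have hSd : DifferentiableOn ℂ S (Metric.ball 0 1) := fun w hw =>
    (hasDerivAt_moebius (moebius_denom_ne_zero hnb
      (mem_ball_zero_iff.1 hw))).differentiableAt.differentiableWithinAt
  have hT0 : T 0 = z := by simp [T]
  have hSb : S b = 0 := by simp [S]
  have hd : DifferentiableOn ℂ (S ∘ F ∘ T) (Metric.ball 0 1) :=
    hSd.comp (hF.comp hTd hTm) (hm.comp hTm)
  have hmap : Set.MapsTo (S ∘ F ∘ T) (Metric.ball 0 1)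
      (Metric.closedBall ((S ∘ F ∘ T) 0) 1) := by
    have : (S ∘ F ∘ T) 0 = 0 := by simp only [Function.comp_apply, hT0, ← hbdef, hSb]
    rw [this]
    exact fun w hw => Metric.ball_subset_closedBall (hSm (hm (hTm hw)))
  have hle := Complex.norm_deriv_le_one_of_mapsTo_ball hd hmap one_pos
  have hT' : HasDerivAt T ((1 - z * conj z) / (1 + conj z * 0) ^ 2) 0 :=
    hasDerivAt_moebius (moebius_denom_ne_zero hz (by simp))
  have hS' : HasDerivAt S ((1 - -b * conj (-b)) / (1 + conj (-b) * b) ^ 2) b :=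
    hasDerivAt_moebius (moebius_denom_ne_zero hnb hb)
  have hF' : HasDerivAt F (deriv F z) z :=
    (hF.differentiableAt (Metric.isOpen_ball.mem_nhds (mem_ball_zero_iff.2 hz))).hasDerivAt
  have hFT : HasDerivAt (F ∘ T) (deriv F z * ((1 - z * conj z) / (1 + conj z * 0) ^ 2)) 0 :=
    HasDerivAt.comp 0 (by rwa [hT0]) hT'
  have hSFT := HasDerivAt.comp (0 : ℂ) (h₂ := S) (h := F ∘ T)
    (by rw [Function.comp_apply, hT0]; exact hS') hFT
  rw [hSFT.deriv] at hle
  have e1 : (1 - -b * conj (-b)) / (1 + conj (-b) * b) ^ 2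
      = (((1 - ‖b‖ ^ 2)⁻¹ : ℝ) : ℂ) := by
    have h1 : (1 + conj (-b) * b) = ((1 - ‖b‖ ^ 2 : ℝ) : ℂ) := by
      rw [← one_sub_mul_conj, map_neg]; ring
    have h2 : (1 - -b * conj (-b)) = ((1 - ‖b‖ ^ 2 : ℝ) : ℂ) := by
      rw [← one_sub_mul_conj, map_neg]; ring
    have h3 : ((1 - ‖b‖ ^ 2 : ℝ) : ℂ) ≠ 0 := Complex.ofReal_ne_zero.2 hb'.ne'
    rw [h1, h2, Complex.ofReal_inv]
    field_simp
  rw [e1, one_sub_mul_conj, mul_zero, add_zero, one_pow, div_one, norm_mul, norm_mul,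
    Complex.norm_real, Complex.norm_real, Real.norm_of_nonneg hz'.le,
    Real.norm_of_nonneg (inv_nonneg.2 hb'.le), inv_mul_le_iff₀ hb', mul_one] at hle
  linarith

namespace IsAnalyticSelfMap

theorem mapsTo (φ : 𝔻 → 𝔻) :
    Set.MapsTo (discExt fun z => (φ z : ℂ)) (Metric.ball 0 1) (Metric.ball 0 1) := by
  intro z hz
  have := discExt_coe (fun z => (φ z : ℂ)) (Complex.UnitDisc.mk z (mem_ball_zero_iff.1 hz))
  rw [Complex.UnitDisc.coe_mk] at this
  rw [this]
  exact coe_mem_ball _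

theorem discExt_comp (φ : 𝔻 → 𝔻) (f : 𝔻 → ℂ) (z : 𝔻) :
    (f ∘ φ) z = (discExt f ∘ discExt fun z => (φ z : ℂ)) z := by
  simp [discExt_coe]

theorem analytic_comp {φ : 𝔻 → 𝔻} (hφ : IsAnalyticSelfMap φ) {f : 𝔻 → ℂ}
    (hf : AnalyticOnDisc f) : AnalyticOnDisc (f ∘ φ) :=
  analyticOnDisc_of_eq (discExt_comp φ f) (DifferentiableOn.comp hf hφ (mapsTo φ))

theorem discDeriv_comp {φ : 𝔻 → 𝔻} (hφ : IsAnalyticSelfMap φ) {f : 𝔻 → ℂ}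
    (hf : AnalyticOnDisc f) (z : 𝔻) :
    discDeriv (f ∘ φ) z = discDeriv f (φ z) * discDeriv (fun z => (φ z : ℂ)) z := by
  rw [discDeriv_of_eq (discExt_comp φ f), deriv_comp]
  · rw [discExt_coe]; rfl
  · rw [discExt_coe]; exact hf.differentiableAt (φ z)
  · exact AnalyticOnDisc.differentiableAt hφ z

theorem blochDensity_comp_le {φ : 𝔻 → 𝔻} (hφ : IsAnalyticSelfMap φ) {f : 𝔻 → ℂ}
    (hf : AnalyticOnDisc f) (z : 𝔻) : blochDensity (f ∘ φ) z ≤ blochDensity f (φ z) := by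
  have h := schwarzPick hφ (mapsTo φ) z.norm_lt_one
  rw [discExt_coe] at h
  have h' : (1 - ‖(z : ℂ)‖ ^ 2) * ‖discDeriv (fun z => (φ z : ℂ)) z‖ ≤
    1 - ‖(φ z : ℂ)‖ ^ 2 := h
  have := mul_le_mul_of_nonneg_right h' (norm_nonneg (discDeriv f (φ z)))
  simp only [blochDensity, discDeriv_comp hφ hf, norm_mul]
  linarith

/-- Composition with an analytic self-map of the disc preserves the Bloch space. -/
theorem isBloch_comp {φ : 𝔻 → 𝔻} (hφ : IsAnalyticSelfMap φ) {f : 𝔻 → ℂ} (hf : IsBloch f) :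
    IsBloch (f ∘ φ) := by
  obtain ⟨hf, A, hA⟩ := hf
  refine ⟨hφ.analytic_comp hf, A, ?_⟩
  rintro _ ⟨z, rfl⟩
  exact (hφ.blochDensity_comp_le hf z).trans (hA ⟨φ z, rfl⟩)

end IsAnalyticSelfMap

theorem isBloch_monomial (n : ℕ) : IsBloch fun z : 𝔻 => (z : ℂ) ^ n := by
  refine ⟨analyticOnDisc_of_eq (g := fun z => z ^ n) (fun _ => rfl)
    (differentiable_pow n).differentiableOn, n, ?_⟩
  rintro _ ⟨z, rfl⟩
  simp only [blochDensity, discDeriv_of_eq (f := fun z : 𝔻 => (z : ℂ) ^ n)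
    (g := fun z => z ^ n) (fun _ => rfl), deriv_pow_field, norm_mul, norm_pow,
    Complex.norm_natCast]
  have h1 : ‖(z : ℂ)‖ ^ (n - 1) ≤ 1 := pow_le_one₀ (norm_nonneg _) z.norm_lt_one.le
  have h2 : 1 - ‖(z : ℂ)‖ ^ 2 ≤ 1 := by linarith [sq_nonneg ‖(z : ℂ)‖]
  calc (1 - ‖(z : ℂ)‖ ^ 2) * (n * ‖(z : ℂ)‖ ^ (n - 1))
      ≤ 1 * (n * 1) := by
        refine mul_le_mul h2 ?_ (by positivity) zero_le_one
        exact mul_le_mul_of_nonneg_left h1 (Nat.cast_nonneg n)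
    _ = n := by ring

/-- The composition operator `C_φ : 𝓑 → 𝓑`, `C_φ f = f ∘ φ`. -/
def compositionOperator (φ : 𝔻 → 𝔻) (hφ : IsAnalyticSelfMap φ) : BlochSpace →ₗ[ℂ] BlochSpace where
  toFun f := BlochSpace.mk (f ∘ φ) (hφ.isBloch_comp f.isBloch)
  map_add' _ _ := rfl
  map_smul' _ _ := rfl

/-- The power `φⁿ`, that is `z ↦ φ(z)ⁿ`, as an element of the Bloch space. -/
def selfMapPow (φ : 𝔻 → 𝔻) (hφ : IsAnalyticSelfMap φ) (n : ℕ) : BlochSpace :=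
  BlochSpace.mk (fun z => (φ z : ℂ) ^ n) (hφ.isBloch_comp (isBloch_monomial n))

end

/-! Write `T` for the linear combination. If `T` is compact, it sends the norm-bounded monomials
into a compact set. Point evaluations are continuous and `φ i z ^ n → 0`, so `0` is the only cluster
point of their images, and the images tend to `0` in norm.

For the converse, the Bloch density of `T f` at `z` is `|∑ μ_i u(a_i)|` with `u = f'`, `a_i =
φ_i(z)`, `μ_i = (1 - |z|²) λ_i φ_i'(z)`. The hypothesis controls the moments `(n + 1) |∑ μ_i a_i ^
n|`, uniformly in `z`. The points may collide or approach the circle and the individual `μ_i` need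
not be small, so the estimate must use only these moments. This is `exists_sum_eval_bound`, whose
constant depends on `k` alone.

Its proof peels off one point `b` at a time: `u = u(b) K² + σ v`, where `K(z) = (1 - |b|²) / (1 -
conj b * z)` and `σ` is the Möbius map vanishing at `b`. Since `K²` is a power series, moments
control its contribution (`norm_sum_kernel_le`). The rest is a combination of one point fewer with
weights `μ_i σ(a_i)`, whose moments stay controlled (`norm_sum_moebius_mul_pow_le`), while `v`
inherits the growth bounds of `u` (`exists_moebius_quotient`).

Montel's theorem then gives subsequences of bounded sequences whose derivatives converge in the
weaker weight `(1 - |z|²)²`. The estimate upgrades this to norm convergence of the images. -/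

/-! ### Möbius interpolation in weighted growth spaces. -/

theorem norm_one_sub_norm_sq {a : ℂ} (ha : ‖a‖ ≤ 1) : ‖1 - (‖a‖ : ℂ) ^ 2‖ = 1 - ‖a‖ ^ 2 := by
  have h : 1 - (‖a‖ : ℂ) ^ 2 = ((1 - ‖a‖ ^ 2 : ℝ) : ℂ) := by push_cast; rfl
  rw [h, Complex.norm_real, Real.norm_of_nonneg (by nlinarith [norm_nonneg a])]

theorem one_sub_norm_le_norm_one_sub_conj_mul {a z : ℂ} (ha : ‖a‖ ≤ 1) :
    1 - ‖z‖ ≤ ‖1 - conj a * z‖ := by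
  have h1 : ‖(1 : ℂ)‖ - ‖conj a * z‖ ≤ ‖1 - conj a * z‖ := norm_sub_norm_le _ _
  rw [norm_one, norm_mul, Complex.norm_conj] at h1
  nlinarith [norm_nonneg z]

theorem one_sub_norm_le_norm_one_sub_conj_mul' {a z : ℂ} (hz : ‖z‖ ≤ 1) :
    1 - ‖a‖ ≤ ‖1 - conj a * z‖ := by
  have h1 : ‖(1 : ℂ)‖ - ‖conj a * z‖ ≤ ‖1 - conj a * z‖ := norm_sub_norm_le _ _
  rw [norm_one, norm_mul, Complex.norm_conj] at h1
  nlinarith [norm_nonneg a]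

theorem norm_one_sub_conj_mul_le {a z : ℂ} (ha : ‖a‖ ≤ 1) :
    ‖1 - conj a * z‖ ≤ 2 * (1 - ‖a‖) + ‖z - a‖ := by
  have e : 1 - conj a * z = ((1 - ‖a‖ ^ 2 : ℝ) : ℂ) - conj a * (z - a) := by
    rw [← one_sub_mul_conj]; ring
  have h := norm_sub_le ((1 - ‖a‖ ^ 2 : ℝ) : ℂ) (conj a * (z - a))
  rw [← e, norm_mul, Complex.norm_conj, Complex.norm_real,
    Real.norm_of_nonneg (by nlinarith [norm_nonneg a])] at h
  nlinarith [norm_nonneg a, norm_nonneg (z - a)]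

theorem one_sub_conj_mul_ne_zero {a z : ℂ} (ha : ‖a‖ ≤ 1) (hz : ‖z‖ < 1) :
    1 - conj a * z ≠ 0 :=
  norm_pos_iff.1 ((sub_pos.2 hz).trans_le (one_sub_norm_le_norm_one_sub_conj_mul ha))

/-- Dividing an analytic function vanishing at `a` by the Möbius map `(a - z) / (1 - conj a * z)`
preserves growth bounds of the form `(1 - |z|²) ^ s |w z| ≤ M`. -/
theorem weighted_dslope_bound {a : ℂ} (ha : ‖a‖ < 1) {w : ℂ → ℂ}
    (hw : DifferentiableOn ℂ w (Metric.ball 0 1)) (hwa : w a = 0) {s : ℕ} {M : ℝ}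
    (hM : ∀ z, ‖z‖ < 1 → (1 - ‖z‖ ^ 2) ^ s * ‖w z‖ ≤ M) {z : ℂ} (hz : ‖z‖ < 1) :
    (1 - ‖z‖ ^ 2) ^ s * ‖(1 - conj a * z) * dslope w a z‖ ≤ 5 * 6 ^ s * M := by
  have hM0 : 0 ≤ M := by simpa [hwa] using hM a ha
  have hd : 0 < 1 - ‖a‖ := sub_pos.2 ha
  have hden := norm_one_sub_conj_mul_le (z := z) ha.le
  have hz2 : 0 < 1 - ‖z‖ ^ 2 := by nlinarith [norm_nonneg z]
  rw [norm_mul]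
  -- Near `a` the Schwarz lemma on the disc of radius `r = (1 - |a|) / 2` bounds the slope; away
  -- from `a` one divides directly, since `1 - conj a * z` is then at most `5 |z - a|`.
  by_cases hza : ‖z - a‖ < (1 - ‖a‖) / 2
  · have hnear : ∀ x : ℂ, ‖x - a‖ < (1 - ‖a‖) / 2 → (1 - ‖a‖) / 2 < 1 - ‖x‖ := fun x hx => by
      have := norm_sub_norm_le x a
      linarith
    have hsub : Metric.ball a ((1 - ‖a‖) / 2) ⊆ Metric.ball 0 1 := fun x hx => by
      have := hnear x (mem_ball_iff_norm.1 hx)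
      rw [mem_ball_zero_iff]
      linarith
    have hmaps : Set.MapsTo w (Metric.ball a ((1 - ‖a‖) / 2))
        (Metric.closedBall (w a) (M / ((1 - ‖a‖) / 2) ^ s)) := fun x hx => by
      have h1 := hnear x (mem_ball_iff_norm.1 hx)
      have h2 : ‖x‖ < 1 := by linarith
      rw [hwa, mem_closedBall_zero_iff, le_div_iff₀ (by positivity), mul_comm]
      refine le_trans ?_ (hM x h2)
      gcongr
      nlinarith [norm_nonneg x]
    have hds := Complex.norm_dslope_le_div_of_mapsTo_ball (hw.mono hsub) hmaps
      (mem_ball_iff_norm.2 hza)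
    -- Here `1 - |z| ≤ (1 - |a|) + |z - a| ≤ 3 r`, and `1 + |z| ≤ 2`.
    have h3 : 1 - ‖z‖ ^ 2 ≤ 6 * ((1 - ‖a‖) / 2) := by
      have h4 := norm_sub_norm_le a z
      rw [norm_sub_rev] at h4
      nlinarith [norm_nonneg z]
    have h5 : ‖1 - conj a * z‖ ≤ 5 * ((1 - ‖a‖) / 2) := by linarith
    set r := (1 - ‖a‖) / 2
    have hr : 0 < r := by positivity
    calc (1 - ‖z‖ ^ 2) ^ s * (‖1 - conj a * z‖ * ‖dslope w a z‖)
        ≤ (6 * r) ^ s * (5 * r * (M / r ^ s / r)) := by gcongr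
      _ = 5 * 6 ^ s * M := by rw [mul_pow]; field_simp
  · rw [not_lt] at hza
    have hpos : 0 < ‖z - a‖ := by linarith
    have hne : z ≠ a := sub_ne_zero.1 (norm_pos_iff.1 hpos)
    have h1 : ‖1 - conj a * z‖ ≤ 5 * ‖z - a‖ := by linarith
    have h2 : ‖dslope w a z‖ = ‖w z‖ / ‖z - a‖ := by
      rw [dslope_of_ne _ hne, slope_def_field, hwa, sub_zero, norm_div]
    have h6 : (1 : ℝ) ≤ 6 ^ s := one_le_pow₀ (by norm_num)
    calc (1 - ‖z‖ ^ 2) ^ s * (‖1 - conj a * z‖ * ‖dslope w a z‖)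
        ≤ (1 - ‖z‖ ^ 2) ^ s * (5 * ‖z - a‖ * (‖w z‖ / ‖z - a‖)) := by rw [h2]; gcongr
      _ = 5 * ((1 - ‖z‖ ^ 2) ^ s * ‖w z‖) := by field_simp
      _ ≤ 5 * M := by linarith [hM z hz]
      _ ≤ 5 * 6 ^ s * M := by nlinarith

/-- Both `1 - |z|²` and `1 - |a|²` are at most `2 |1 - conj a * z|`. The squared kernel supplies two
factors of the denominator, enough to absorb the weight for either exponent. -/
theorem weighted_kernel_bound {a : ℂ} (ha : ‖a‖ < 1) {c : ℂ} {s : ℕ} (hs1 : 1 ≤ s) (hs2 : s ≤ 2)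
    {M : ℝ} (hM : (1 - ‖a‖ ^ 2) ^ s * ‖c‖ ≤ M) {z : ℂ} (hz : ‖z‖ < 1) :
    (1 - ‖z‖ ^ 2) ^ s * ‖c * ((1 - (‖a‖ : ℂ) ^ 2) / (1 - conj a * z)) ^ 2‖ ≤ 4 * M := by
  have hD := norm_pos_iff.2 (one_sub_conj_mul_ne_zero ha.le hz)
  have h1 := one_sub_norm_le_norm_one_sub_conj_mul (z := z) ha.le
  have h2 := one_sub_norm_le_norm_one_sub_conj_mul' (a := a) hz.le
  have hz' : 0 ≤ 1 - ‖z‖ ^ 2 := by nlinarith [norm_nonneg z]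
  have ha' : 0 ≤ 1 - ‖a‖ ^ 2 := by nlinarith [norm_nonneg a]
  have e : ‖1 - (‖a‖ : ℂ) ^ 2‖ = 1 - ‖a‖ ^ 2 := norm_one_sub_norm_sq ha.le
  rw [norm_mul, norm_pow, norm_div, e]
  set D := ‖1 - conj a * z‖
  have hp : 1 - ‖z‖ ^ 2 ≤ 2 * D := by nlinarith [norm_nonneg z]
  have hq : 1 - ‖a‖ ^ 2 ≤ 2 * D := by nlinarith [norm_nonneg a]
  have key : (1 - ‖z‖ ^ 2) ^ s * (1 - ‖a‖ ^ 2) ^ 2 ≤ (1 - ‖a‖ ^ 2) ^ s * (4 * D ^ 2) := by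
    interval_cases s
    · nlinarith [mul_le_mul hp hq ha' (by positivity)]
    · nlinarith [pow_le_pow_left₀ hz' hp 2, sq_nonneg (1 - ‖a‖ ^ 2)]
  calc (1 - ‖z‖ ^ 2) ^ s * (‖c‖ * ((1 - ‖a‖ ^ 2) / D) ^ 2)
      = ((1 - ‖z‖ ^ 2) ^ s * (1 - ‖a‖ ^ 2) ^ 2) * ‖c‖ / D ^ 2 := by ring
    _ ≤ ((1 - ‖a‖ ^ 2) ^ s * (4 * D ^ 2)) * ‖c‖ / D ^ 2 := by gcongr
    _ = 4 * ((1 - ‖a‖ ^ 2) ^ s * ‖c‖) := by field_simp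
    _ ≤ 4 * M := by linarith

/-- One step of Newton interpolation with Möbius maps in the weighted spaces
`sup (1 - |z|²) ^ s |u z| < ∞`, `s = 1, 2`. -/
theorem exists_moebius_quotient {a : ℂ} (ha : ‖a‖ < 1) {u : ℂ → ℂ}
    (hu : DifferentiableOn ℂ u (Metric.ball 0 1)) :
    ∃ v : ℂ → ℂ, DifferentiableOn ℂ v (Metric.ball 0 1) ∧
      (∀ z, ‖z‖ < 1 → u z = u a * ((1 - (‖a‖ : ℂ) ^ 2) / (1 - conj a * z)) ^ 2 +
        (a - z) / (1 - conj a * z) * v z) ∧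
      ∀ s : ℕ, 1 ≤ s → s ≤ 2 → ∀ M : ℝ, (∀ z, ‖z‖ < 1 → (1 - ‖z‖ ^ 2) ^ s * ‖u z‖ ≤ M) →
        ∀ z, ‖z‖ < 1 → (1 - ‖z‖ ^ 2) ^ s * ‖v z‖ ≤ 900 * M := by
  have haa : 1 - (‖a‖ : ℂ) ^ 2 = 1 - conj a * a := by
    rw [mul_comm, one_sub_mul_conj]; push_cast; rfl
  let w : ℂ → ℂ := fun z => u z - u a * ((1 - (‖a‖ : ℂ) ^ 2) / (1 - conj a * z)) ^ 2
  have hwa : w a = 0 := by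
    simp only [w, haa]
    rw [div_self (one_sub_conj_mul_ne_zero ha.le ha)]
    ring
  have hden : DifferentiableOn ℂ (fun z => 1 - conj a * z) (Metric.ball 0 1) := by fun_prop
  have hw : DifferentiableOn ℂ w (Metric.ball 0 1) :=
    hu.sub (((DifferentiableOn.div (differentiableOn_const _) hden fun z hz =>
      one_sub_conj_mul_ne_zero ha.le (mem_ball_zero_iff.1 hz)).pow 2).const_mul _)
  refine ⟨fun z => -((1 - conj a * z) * dslope w a z), ?_, fun z hz => ?_, ?_⟩
  · exact (hden.mul ((Complex.differentiableOn_dslope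
      (Metric.isOpen_ball.mem_nhds (mem_ball_zero_iff.2 ha))).2 hw)).neg
  · have h1 := one_sub_conj_mul_ne_zero ha.le hz
    have h2 : (z - a) * dslope w a z = w z := by
      have := sub_smul_dslope w a z
      rwa [hwa, sub_zero, smul_eq_mul] at this
    have h3 : (a - z) / (1 - conj a * z) * -((1 - conj a * z) * dslope w a z) = w z := by
      rw [div_mul_eq_mul_div, div_eq_iff h1, ← h2]; ring
    rw [h3]
    simp only [w]
    ring
  · intro s hs1 hs2 M hM z hz
    have hM0 : 0 ≤ M := le_trans (by simp) (hM 0 (by simp))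
    -- `5 = 1 + 4`: the function itself plus its kernel term.
    have hwM : ∀ z, ‖z‖ < 1 → (1 - ‖z‖ ^ 2) ^ s * ‖w z‖ ≤ 5 * M := fun z hz => by
      have h1 := weighted_kernel_bound ha hs1 hs2 (hM a ha) hz
      have h2 := hM z hz
      have h3 : 0 ≤ (1 - ‖z‖ ^ 2) ^ s := pow_nonneg (by nlinarith [norm_nonneg z]) s
      have h4 := mul_le_mul_of_nonneg_left (norm_sub_le (u z)
        (u a * ((1 - (‖a‖ : ℂ) ^ 2) / (1 - conj a * z)) ^ 2)) h3
      rw [mul_add] at h4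
      simp only [w]
      linarith
    rw [norm_neg]
    refine (weighted_dslope_bound ha hw hwa hwM hz).trans ?_
    -- `900 = 5 * 6 ^ 2 * 5`.
    have : (6 : ℝ) ^ s ≤ 6 ^ 2 := pow_le_pow_right₀ (by norm_num) hs2
    nlinarith

/-! ### Estimating combinations of point evaluations by their moments. -/

section Functional

variable {ι : Type*} [Fintype ι] {μ a : ι → ℂ}

/-- Expand `1 / (1 - conj b * a)² = ∑ (n + 1) (conj b * a) ^ n`: the first `N` moments cost `E`
each, and the later ones a geometric series with ratio `|b|`. -/
theorem norm_sum_kernel_le (ha : ∀ i, ‖a i‖ < 1) {b : ℂ} (hb : ‖b‖ < 1) {E e : ℝ} {N : ℕ}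
    (hE : ∀ n : ℕ, (n + 1) * ‖∑ i, μ i * a i ^ n‖ ≤ E)
    (he : ∀ n ≥ N, (n + 1) * ‖∑ i, μ i * a i ^ n‖ ≤ e) :
    ‖∑ i, μ i * ((1 - (‖b‖ : ℂ) ^ 2) / (1 - conj b * a i)) ^ 2‖ ≤
      (1 - ‖b‖ ^ 2) ^ 2 * (N * E + e / (1 - ‖b‖)) := by
  have hE0 : 0 ≤ E := le_trans (by positivity) (hE 0)
  have he0 : 0 ≤ e := le_trans (by positivity) (he N le_rfl)
  have hb' : 0 ≤ 1 - ‖b‖ ^ 2 := by nlinarith [norm_nonneg b]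
  have e1 : ‖1 - (‖b‖ : ℂ) ^ 2‖ = 1 - ‖b‖ ^ 2 := norm_one_sub_norm_sq hb.le
  have e2 : ∑ i, μ i * ((1 - (‖b‖ : ℂ) ^ 2) / (1 - conj b * a i)) ^ 2 =
      (1 - (‖b‖ : ℂ) ^ 2) ^ 2 * ∑ i, μ i * (1 / (1 - conj b * a i) ^ 2) := by
    rw [Finset.mul_sum]
    refine Finset.sum_congr rfl fun i _ => ?_
    rw [div_pow]
    ring
  rw [e2, norm_mul, norm_pow, e1]
  gcongr
  have hs : HasSum (fun n : ℕ => ∑ i, μ i * ((n + 1 : ℂ) * (conj b * a i) ^ n))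
      (∑ i, μ i * (1 / (1 - conj b * a i) ^ 2)) := by
    refine hasSum_sum fun i _ => HasSum.mul_left _ ?_
    have hlt : ‖conj b * a i‖ < 1 := by
      rw [norm_mul, Complex.norm_conj]
      nlinarith [ha i, norm_nonneg b, norm_nonneg (a i)]
    simpa using hasSum_choose_mul_geometric_of_norm_lt_one 1 hlt
  have hg : HasSum (fun n : ℕ => (if n ∈ Finset.range N then E else 0) + e * ‖b‖ ^ n)
      (N * E + e / (1 - ‖b‖)) := by
    refine HasSum.add ?_ ((hasSum_geometric_of_lt_one (norm_nonneg b) hb).mul_left e)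
    have := hasSum_sum_of_ne_finset_zero (L := .unconditional ℕ)
      (f := fun n => if n ∈ Finset.range N then E else 0)
      (s := Finset.range N) (fun n hn => if_neg hn)
    rw [Finset.sum_congr rfl (fun n hn => if_pos hn)] at this
    simpa using this
  refine hs.norm_le_of_bounded hg fun n => ?_
  have e3 : ∑ i, μ i * ((n + 1 : ℂ) * (conj b * a i) ^ n) =
      conj b ^ n * ((n + 1 : ℕ) * ∑ i, μ i * a i ^ n) := by
    rw [Finset.mul_sum, Finset.mul_sum]
    refine Finset.sum_congr rfl fun i _ => ?_
    rw [mul_pow]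
    push_cast
    ring
  rw [e3, norm_mul, norm_mul, norm_pow, Complex.norm_conj, Complex.norm_natCast]
  push_cast
  have hb1 : ‖b‖ ^ n ≤ 1 := pow_le_one₀ (norm_nonneg b) hb.le
  have hb0 : 0 ≤ ‖b‖ ^ n := by positivity
  by_cases hn : n ∈ Finset.range N
  · rw [if_pos hn]
    nlinarith [hE n, mul_nonneg he0 hb0]
  · rw [if_neg hn, zero_add, mul_comm]
    rw [Finset.mem_range, not_lt] at hn
    exact mul_le_mul_of_nonneg_right (he n hn) hb0

/-- Expanding the Möbius factor as `b - (1 - |b|²) ∑ conj b ^ m * a ^ (m + 1)` leaves only moments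
of degree at least `n`. The total is `|b| Y + (1 + |b|) Y`. -/
theorem norm_sum_moebius_mul_pow_le (ha : ∀ i, ‖a i‖ < 1) {b : ℂ} (hb : ‖b‖ < 1) {Y : ℝ} {n : ℕ}
    (hY : ∀ m ≥ n, ‖∑ i, μ i * a i ^ m‖ ≤ Y) :
    ‖∑ i, μ i * ((b - a i) / (1 - conj b * a i)) * a i ^ n‖ ≤ 3 * Y := by
  have hY0 : 0 ≤ Y := (norm_nonneg _).trans (hY n le_rfl)
  have hb' : 0 ≤ 1 - ‖b‖ ^ 2 := by nlinarith [norm_nonneg b]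
  have e1 : ∑ i, μ i * ((b - a i) / (1 - conj b * a i)) * a i ^ n =
      b * ∑ i, μ i * a i ^ n -
        ((1 - ‖b‖ ^ 2 : ℝ) : ℂ) * ∑ i, μ i * a i ^ (n + 1) * (1 - conj b * a i)⁻¹ := by
    rw [Finset.mul_sum, Finset.mul_sum, ← Finset.sum_sub_distrib]
    refine Finset.sum_congr rfl fun i _ => ?_
    have h := mul_inv_cancel₀ (one_sub_conj_mul_ne_zero hb.le (ha i))
    rw [← one_sub_mul_conj, div_eq_mul_inv]
    linear_combination μ i * a i ^ n * b * h
  have hs : HasSum (fun m : ℕ => ∑ i, μ i * a i ^ (n + 1) * (conj b * a i) ^ m)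
      (∑ i, μ i * a i ^ (n + 1) * (1 - conj b * a i)⁻¹) := by
    refine hasSum_sum fun i _ => HasSum.mul_left _ (hasSum_geometric_of_norm_lt_one ?_)
    rw [norm_mul, Complex.norm_conj]
    nlinarith [ha i, norm_nonneg b, norm_nonneg (a i)]
  have h2 := hs.norm_le_of_bounded
    ((hasSum_geometric_of_lt_one (norm_nonneg b) hb).mul_left Y) fun m => by
      have e3 : ∑ i, μ i * a i ^ (n + 1) * (conj b * a i) ^ m =
          conj b ^ m * ∑ i, μ i * a i ^ (n + 1 + m) := by
        rw [Finset.mul_sum]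
        refine Finset.sum_congr rfl fun i _ => ?_
        ring
      rw [e3, norm_mul, norm_pow, Complex.norm_conj, mul_comm]
      exact mul_le_mul_of_nonneg_right (hY _ (by omega)) (by positivity)
  have h3 : (1 - ‖b‖ ^ 2) * (Y * (1 - ‖b‖)⁻¹) = (1 + ‖b‖) * Y := by
    have : 1 - ‖b‖ ≠ 0 := (sub_pos.2 hb).ne'
    field_simp
    ring
  rw [e1]
  refine (norm_sub_le _ _).trans ?_
  rw [norm_mul, norm_mul, Complex.norm_real, Real.norm_of_nonneg hb']
  have h4 := mul_le_mul_of_nonneg_left h2 hb'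
  rw [h3] at h4
  nlinarith [mul_le_mul hb.le (hY n le_rfl) (norm_nonneg _) zero_le_one]

end Functional

/-- A combination of `k` point evaluations that is small on the monomials of high degree is small
on functions `u` with `(1 - |z|²) |u z|` bounded and `(1 - |z|²)² |u z|` small, with a constant
independent of the points and of the weights. -/
theorem exists_sum_eval_bound (k : ℕ) : ∃ C : ℝ, 0 ≤ C ∧ ∀ (μ a : Fin k → ℂ), (∀ i, ‖a i‖ < 1) →
    ∀ (E e : ℝ) (N : ℕ), (∀ n : ℕ, (n + 1) * ‖∑ i, μ i * a i ^ n‖ ≤ E) →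
      (∀ n ≥ N, (n + 1) * ‖∑ i, μ i * a i ^ n‖ ≤ e) →
    ∀ (u : ℂ → ℂ) (M η : ℝ), DifferentiableOn ℂ u (Metric.ball 0 1) →
      (∀ z, ‖z‖ < 1 → (1 - ‖z‖ ^ 2) * ‖u z‖ ≤ M) →
      (∀ z, ‖z‖ < 1 → (1 - ‖z‖ ^ 2) ^ 2 * ‖u z‖ ≤ η) →
      ‖∑ i, μ i * u (a i)‖ ≤ C * (N * E * η + e * M) := by
  induction k with
  | zero => exact ⟨0, le_rfl, fun μ a _ E e N _ _ u M η _ _ _ => by simp⟩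
  | succ k ih =>
    obtain ⟨C, hC0, hC⟩ := ih
    -- `2` pays for the kernel term; `2700 = 3 * 900` combines the loss in the moments with that in
    -- the growth of the quotient.
    refine ⟨2 + 2700 * C, by positivity, ?_⟩
    intro μ a ha E e N hE he u M η hu hM hη
    have hE0 : 0 ≤ E := le_trans (by positivity) (hE 0)
    have he0 : 0 ≤ e := le_trans (by positivity) (he N le_rfl)
    have hM0 : 0 ≤ M := le_trans (by simp) (hM 0 (by simp))
    have hη0 : 0 ≤ η := le_trans (by simp) (hη 0 (by simp))
    obtain ⟨v, hv, huv, hvb⟩ := exists_moebius_quotient (ha 0) hu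
    set b := a 0 with hb
    have hb1 : ‖b‖ < 1 := ha 0
    let σ : ℂ → ℂ := fun z => (b - z) / (1 - conj b * z)
    have hσ0 : σ (a 0) = 0 := by simp [σ, hb]
    have e1 : ∑ i, μ i * u (a i) =
        u b * ∑ i, μ i * ((1 - (‖b‖ : ℂ) ^ 2) / (1 - conj b * a i)) ^ 2 +
        ∑ i : Fin k, (μ i.succ * σ (a i.succ)) * v (a i.succ) := by
      -- The point with index `0` drops out because `σ` vanishes there; this is what lowers `k`.
      have h0 : ∑ i : Fin k, (μ i.succ * σ (a i.succ)) * v (a i.succ) =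
          ∑ i, (μ i * σ (a i)) * v (a i) := by
        rw [Fin.sum_univ_succ, hσ0]
        ring
      rw [h0, Finset.mul_sum, ← Finset.sum_add_distrib]
      refine Finset.sum_congr rfl fun i _ => ?_
      rw [huv _ (ha i)]
      ring
    have hmon : ∀ n : ℕ, ∀ X : ℝ, (∀ m ≥ n, (m + 1) * ‖∑ i, μ i * a i ^ m‖ ≤ X) →
        (n + 1) * ‖∑ i : Fin k, (μ i.succ * σ (a i.succ)) * a i.succ ^ n‖ ≤ 3 * X := by
      intro n X hX
      have h0 : ∑ i : Fin k, (μ i.succ * σ (a i.succ)) * a i.succ ^ n =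
          ∑ i, (μ i * σ (a i)) * a i ^ n := by
        rw [Fin.sum_univ_succ, hσ0]
        ring
      have hn : (0 : ℝ) < n + 1 := by positivity
      rw [h0]
      -- The factor `m + 1` grows with `m`, so all moments of degree at least `n` are bounded by `X
      -- / (n + 1)`.
      have := norm_sum_moebius_mul_pow_le (μ := μ) ha hb1 (Y := X / (n + 1)) (n := n)
        fun m hm => by
          rw [le_div_iff₀ hn, mul_comm]
          refine le_trans ?_ (hX m hm)
          gcongr
      calc (n + 1) * ‖∑ i, (μ i * σ (a i)) * a i ^ n‖ ≤ (n + 1) * (3 * (X / (n + 1))) := by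
            gcongr
        _ = 3 * X := by field_simp
    have h2 := hC (fun i => μ i.succ * σ (a i.succ)) (fun i => a i.succ) (fun i => ha _)
      (3 * E) (3 * e) N (fun n => hmon n E fun m _ => hE m)
      (fun n hn => hmon n e fun m hm => he m (hn.trans hm)) v (900 * M) (900 * η) hv
      (fun z hz => by simpa using hvb 1 le_rfl (by norm_num) M (by simpa using hM) z hz)
      (hvb 2 (by norm_num) le_rfl η hη)
    have h1 := norm_sum_kernel_le ha hb1 hE he
    have hd : 0 < 1 - ‖b‖ := sub_pos.2 hb1
    have hk : ‖u b * ∑ i, μ i * ((1 - (‖b‖ : ℂ) ^ 2) / (1 - conj b * a i)) ^ 2‖ ≤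
        N * E * η + 2 * (e * M) := by
      rw [norm_mul]
      -- The tail's `1 / (1 - |b|)` cancels one weight factor, so it needs only `M`; the first `N`
      -- terms keep both factors and use `η`.
      have h3 : (1 - ‖b‖ ^ 2) ^ 2 * (e / (1 - ‖b‖)) * ‖u b‖ =
          (1 + ‖b‖) * e * ((1 - ‖b‖ ^ 2) * ‖u b‖) := by
        field_simp
        ring
      have hNE : 0 ≤ N * E := by positivity
      calc _ ≤ ‖u b‖ * ((1 - ‖b‖ ^ 2) ^ 2 * (N * E + e / (1 - ‖b‖))) := by gcongr
        _ = N * E * ((1 - ‖b‖ ^ 2) ^ 2 * ‖u b‖) +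
            (1 - ‖b‖ ^ 2) ^ 2 * (e / (1 - ‖b‖)) * ‖u b‖ := by ring
        _ ≤ N * E * η + 2 * (e * M) := by
          rw [h3]
          refine add_le_add (mul_le_mul_of_nonneg_left (hη b hb1) hNE) ?_
          have : (1 + ‖b‖) * e * ((1 - ‖b‖ ^ 2) * ‖u b‖) ≤ (1 + ‖b‖) * e * M :=
            mul_le_mul_of_nonneg_left (hM b hb1) (by positivity)
          nlinarith [mul_nonneg he0 hM0]
    rw [e1]
    refine (norm_add_le _ _).trans ((add_le_add hk h2).trans ?_)
    have : 0 ≤ N * E * η := by positivity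
    linear_combination this

/-! ### Normal families, by compactness of Taylor coefficients. -/

/-- **Montel's theorem** on the unit disc. -/
theorem exists_subseq_tendstoLocallyUniformlyOn_ball {F : ℕ → ℂ → ℂ}
    (hF : ∀ m, DifferentiableOn ℂ (F m) (Metric.ball 0 1))
    (hb : ∀ s : ℝ, 0 < s → s < 1 → ∃ A : ℝ, ∀ m z, ‖z‖ ≤ s → ‖F m z‖ ≤ A) :
    ∃ (ψ : ℕ → ℕ) (f : ℂ → ℂ), StrictMono ψ ∧
      TendstoLocallyUniformlyOn (fun m => F (ψ m)) f atTop (Metric.ball 0 1) := by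
  let c : ℕ → ℕ → ℂ := fun m n => (n.factorial : ℂ)⁻¹ * iteratedDeriv n (F m) 0
  have hsum : ∀ m z, ‖z‖ < 1 → HasSum (fun n => c m n * z ^ n) (F m z) := fun m z hz => by
    have := Complex.hasSum_taylorSeries_on_ball (hF m) (mem_ball_zero_iff.2 hz)
    have e : (fun n => c m n * z ^ n) = fun n : ℕ =>
        (n.factorial : ℂ)⁻¹ • (z - 0) ^ n • iteratedDeriv n (F m) 0 := by
      funext n
      simp only [c, smul_eq_mul, sub_zero]
      ring
    rwa [e]
  have hc : ∀ s : ℝ, 0 < s → s < 1 → ∃ A : ℝ, ∀ m n, ‖c m n‖ ≤ A / s ^ n := by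
    intro s hs0 hs1
    obtain ⟨A, hA⟩ := hb s hs0 hs1
    refine ⟨A, fun m n => ?_⟩
    have hd : DiffContOnCl ℂ (F m) (Metric.ball 0 s) :=
      ((hF m).mono (Metric.closedBall_subset_ball hs1)).diffContOnCl_ball subset_rfl
    have := Complex.norm_iteratedDeriv_le_of_forall_mem_sphere_norm_le n hs0 hd
      (fun z hz => hA m z (mem_sphere_zero_iff_norm.1 hz).le)
    have hn : (0 : ℝ) < n.factorial := by positivity
    simp only [c]
    rw [norm_mul, norm_inv, Complex.norm_natCast, inv_mul_le_iff₀ hn]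
    calc _ ≤ _ := this
      _ = _ := by ring
  -- Cauchy estimates at one fixed radius already place all coefficient sequences in a compact
  -- product of discs.
  obtain ⟨A₀, hA₀⟩ := hc (1 / 2) (by norm_num) (by norm_num)
  have hcpt : IsCompact (Set.univ.pi fun n : ℕ => Metric.closedBall (0 : ℂ) (A₀ / (1 / 2) ^ n)) :=
    isCompact_univ_pi fun n => isCompact_closedBall _ _
  obtain ⟨d, -, ψ, hψ, hd⟩ := hcpt.isSeqCompact (x := c)
    (fun m n _ => mem_closedBall_zero_iff.2 (hA₀ m n))
  rw [tendsto_pi_nhds] at hd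
  refine ⟨ψ, fun z => ∑' n, d n * z ^ n, hψ, ?_⟩
  rw [tendstoLocallyUniformlyOn_iff_forall_isCompact Metric.isOpen_ball]
  intro K hK hKc
  obtain ⟨R, hR0, hR1, hKR⟩ : ∃ R : ℝ, 0 < R ∧ R < 1 ∧ ∀ z ∈ K, ‖z‖ ≤ R := by
    obtain ⟨R, hR, hR'⟩ := exists_pos_lt_subset_ball one_pos hKc.isClosed hK
    exact ⟨R, hR.1, hR.2, fun z hz => (mem_ball_zero_iff.1 (hR' hz)).le⟩
  -- Cauchy estimates at a radius `s > R` give the summable majorant `(R / s) ^ n` for dominated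
  -- convergence.
  obtain ⟨s, hRs, hs1⟩ := exists_between hR1
  have hs0 := hR0.trans hRs
  obtain ⟨A, hA⟩ := hc s hs0 hs1
  have hdA : ∀ n, ‖d n‖ ≤ A / s ^ n := fun n =>
    le_of_tendsto (hd n).norm (Eventually.of_forall fun m => hA _ n)
  have hgeo : Summable fun n : ℕ => (2 * A) * (R / s) ^ n :=
    (summable_geometric_of_lt_one (by positivity) ((div_lt_one hs0).2 hRs)).mul_left _
  have hbd : ∀ m n, ‖c (ψ m) n - d n‖ * R ^ n ≤ (2 * A) * (R / s) ^ n := fun m n => by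
    calc _ ≤ (A / s ^ n + A / s ^ n) * R ^ n := by
          gcongr
          exact (norm_sub_le _ _).trans (add_le_add (hA _ n) (hdA n))
      _ = _ := by rw [div_pow]; ring
  have hlim : Tendsto (fun m => ∑' n, ‖c (ψ m) n - d n‖ * R ^ n) atTop (𝓝 0) := by
    have := tendsto_tsum_of_dominated_convergence (𝓕 := atTop)
      (f := fun m n => ‖c (ψ m) n - d n‖ * R ^ n) (g := fun _ => (0 : ℝ)) hgeo
      (fun n => by
        have h1 := ((hd n).sub_const (d n)).norm.mul_const (R ^ n)
        simpa using h1)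
      (Eventually.of_forall fun m n => by
        rw [Real.norm_of_nonneg (by positivity)]
        exact hbd m n)
    simpa using this
  rw [Metric.tendstoUniformlyOn_iff]
  intro ε hε
  filter_upwards [hlim.eventually_lt_const hε] with m hm z hz
  have hzR := hKR z hz
  have hz1 : ‖z‖ < 1 := hzR.trans_lt hR1
  have hds : Summable fun n => d n * z ^ n := by
    refine Summable.of_norm_bounded (g := fun n => A * (R / s) ^ n)
      ((summable_geometric_of_lt_one (by positivity) ((div_lt_one hs0).2 hRs)).mul_left _)
      fun n => ?_
    rw [norm_mul, norm_pow]
    calc _ ≤ A / s ^ n * R ^ n := by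
          gcongr
          · exact (norm_nonneg _).trans (hdA n)
          · exact hdA n
      _ = _ := by rw [div_pow]; ring
  have hdiff : HasSum (fun n => (c (ψ m) n - d n) * z ^ n) (F (ψ m) z - ∑' n, d n * z ^ n) := by
    simpa only [sub_mul] using (hsum (ψ m) z hz1).sub hds.hasSum
  have hmaj : Summable fun n => ‖c (ψ m) n - d n‖ * R ^ n :=
    Summable.of_nonneg_of_le (fun n => by positivity) (hbd m) hgeo
  rw [dist_comm, dist_eq_norm]
  refine lt_of_le_of_lt (hdiff.norm_le_of_bounded hmaj.hasSum fun n => ?_) hm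
  rw [norm_mul, norm_pow]
  gcongr

/-! ### Evaluations, monomials and bounded sequences in the Bloch space. -/

namespace BlochSpace

/-- Evaluation at a point of the disc, as a linear functional on the Bloch space. -/
noncomputable def evalₗ (z : 𝔻) : BlochSpace →ₗ[ℂ] ℂ where
  toFun f := f z
  map_add' _ _ := rfl
  map_smul' _ _ := rfl

/-- Evaluation of the derivative at a point of the disc, as a linear functional on the Bloch
space. -/
noncomputable def derivₗ (z : 𝔻) : BlochSpace →ₗ[ℂ] ℂ where
  toFun f := discDeriv f z
  map_add' f g := discDeriv_add f.isBloch.1 g.isBloch.1 z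
  map_smul' c f := discDeriv_smul c f.isBloch.1 z

theorem evalₗ_apply (z : 𝔻) (f : BlochSpace) : evalₗ z f = f z := rfl

theorem derivₗ_apply (z : 𝔻) (f : BlochSpace) : derivₗ z f = discDeriv f z := rfl

theorem norm_eval_zero_add_blochDensity_le (f : BlochSpace) (z : 𝔻) :
    ‖f 0‖ + blochDensity f z ≤ ‖f‖ := by
  rw [norm_def]
  exact add_le_add le_rfl (f.blochDensity_le z)

theorem blochDensity_le_norm (f : BlochSpace) (z : 𝔻) : blochDensity f z ≤ ‖f‖ :=
  le_trans (le_add_of_nonneg_left (norm_nonneg _)) (f.norm_eval_zero_add_blochDensity_le z)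

theorem norm_le_of_forall {f : BlochSpace} {A B : ℝ} (h0 : ‖f 0‖ ≤ A)
    (h : ∀ z, blochDensity f z ≤ B) : ‖f‖ ≤ A + B := by
  rw [norm_def]
  exact add_le_add h0 (ciSup_le h)

theorem weighted_norm_deriv_le (f : BlochSpace) {z : ℂ} (hz : ‖z‖ < 1) :
    (1 - ‖z‖ ^ 2) * ‖deriv (discExt f) z‖ ≤ ‖f‖ :=
  f.blochDensity_le_norm (Complex.UnitDisc.mk z hz)

theorem differentiableOn_deriv (f : BlochSpace) :
    DifferentiableOn ℂ (deriv (discExt f)) (Metric.ball 0 1) :=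
  DifferentiableOn.deriv f.isBloch.1 Metric.isOpen_ball

/-- The mean value inequality on the disc of radius `s`; it supplies local boundedness for Montel's
theorem and continuity of evaluations. -/
theorem norm_discExt_le (f : BlochSpace) {s : ℝ} (hs : s < 1) {z : ℂ} (hz : ‖z‖ ≤ s) :
    ‖discExt f z‖ ≤ (1 + 1 / (1 - s ^ 2)) * ‖f‖ := by
  have hs0 : 0 ≤ s := (norm_nonneg z).trans hz
  have hs2 : 0 < 1 - s ^ 2 := by nlinarith
  have hd : ∀ x ∈ Metric.closedBall (0 : ℂ) s, ‖deriv (discExt f) x‖ ≤ 1 / (1 - s ^ 2) * ‖f‖ := by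
    intro x hx
    have hx' : ‖x‖ ≤ s := mem_closedBall_zero_iff.1 hx
    have h1 := f.weighted_norm_deriv_le (hx'.trans_lt hs)
    rw [one_div, ← div_eq_inv_mul, le_div_iff₀ hs2, mul_comm]
    refine le_trans ?_ h1
    gcongr
  have h := (convex_closedBall (0 : ℂ) s).norm_image_sub_le_of_norm_deriv_le
    (fun x hx => DifferentiableOn.differentiableAt f.isBloch.1 (Metric.isOpen_ball.mem_nhds
      (Metric.closedBall_subset_ball hs hx))) hd
    (Metric.mem_closedBall_self hs0) (mem_closedBall_zero_iff.2 hz)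
  rw [sub_zero] at h
  have h0 : ‖discExt f 0‖ ≤ ‖f‖ := by
    have := f.norm_eval_zero_add_blochDensity_le 0
    have e : discExt f 0 = f 0 := discExt_coe f 0
    rw [e]
    linarith [blochDensity_nonneg f 0]
  have h2 : 1 / (1 - s ^ 2) * ‖f‖ * ‖z‖ ≤ 1 / (1 - s ^ 2) * ‖f‖ * 1 := by
    gcongr
    linarith
  have h3 := norm_sub_norm_le (discExt f z) (discExt f 0)
  linarith

theorem continuous_eval (z : 𝔻) : Continuous fun f : BlochSpace => f z :=
  AddMonoidHomClass.continuous_of_bound (evalₗ z) (1 + 1 / (1 - ‖(z : ℂ)‖ ^ 2)) fun f => by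
    rw [evalₗ_apply, ← discExt_coe f z]
    exact f.norm_discExt_le z.norm_lt_one le_rfl

/-- The monomial `z ^ n` as an element of the Bloch space. -/
noncomputable def monomial (n : ℕ) : BlochSpace := mk (fun z => (z : ℂ) ^ n) (isBloch_monomial n)

theorem norm_monomial_le (n : ℕ) : ‖monomial n‖ ≤ 1 + 2 := by
  refine norm_le_of_forall ?_ fun z => ?_
  · rw [monomial, mk_apply, norm_pow]
    exact pow_le_one₀ (norm_nonneg _) (by simp)
  · have e : discDeriv (monomial n) z = n * (z : ℂ) ^ (n - 1) := by
      rw [discDeriv_of_eq (f := monomial n) (g := fun z => z ^ n) (fun _ => rfl), deriv_pow_field]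
    rw [blochDensity, e, norm_mul, norm_pow, Complex.norm_natCast]
    have hr0 := norm_nonneg (z : ℂ)
    have hr1 := z.norm_lt_one
    set r := ‖(z : ℂ)‖
    -- Comparing with the geometric sum gives `n r ^ (n - 1) (1 - r) ≤ 1`; the factor `1 + r ≤ 2`
    -- then yields a bound independent of `n`.
    have h1 : n * r ^ (n - 1) ≤ ∑ j ∈ Finset.range n, r ^ j := by
      have := Finset.card_nsmul_le_sum (Finset.range n) (fun j => r ^ j) (r ^ (n - 1))
        fun j hj => pow_le_pow_of_le_one hr0 hr1.le (by have := Finset.mem_range.1 hj; omega)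
      simpa using this
    have h2 : (∑ j ∈ Finset.range n, r ^ j) * (1 - r) ≤ 1 := by
      have h3 := geom_sum_mul_neg r n
      have h4 : 0 ≤ r ^ n := by positivity
      linarith
    have h5 : n * r ^ (n - 1) * (1 - r) ≤ 1 :=
      (mul_le_mul_of_nonneg_right h1 (by linarith)).trans h2
    nlinarith

/-- Bounded sequences in the Bloch space have subsequences that converge in the seminorm
`sup (1 - |z|²)² |f' z|`, and pointwise. -/
theorem exists_subseq_tendsto_of_norm_le_one {f : ℕ → BlochSpace} (hf : ∀ m, ‖f m‖ ≤ 1) :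
    ∃ (ψ : ℕ → ℕ) (g : BlochSpace), StrictMono ψ ∧ ‖g‖ ≤ 1 ∧
      (∀ z, Tendsto (fun m => f (ψ m) z) atTop (𝓝 (g z))) ∧
      ∀ η > 0, ∀ᶠ m in atTop, ∀ z : ℂ, ‖z‖ < 1 →
        (1 - ‖z‖ ^ 2) ^ 2 * ‖deriv (discExt (f (ψ m) - g)) z‖ ≤ η := by
  obtain ⟨ψ, G, hψ, hG⟩ := exists_subseq_tendstoLocallyUniformlyOn_ball
    (F := fun m => discExt (f m)) (fun m => (f m).isBloch.1) fun s _ hs1 =>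
      ⟨1 + 1 / (1 - s ^ 2), fun m z hz => ((f m).norm_discExt_le hs1 hz).trans (by
        have : 0 < 1 - s ^ 2 := by nlinarith
        exact mul_le_of_le_one_right (by positivity) (hf m))⟩
  have hd : ∀ᶠ m in atTop, DifferentiableOn ℂ (discExt (f (ψ m))) (Metric.ball 0 1) :=
    Eventually.of_forall fun m => (f (ψ m)).isBloch.1
  have hGd := hG.differentiableOn hd Metric.isOpen_ball
  have hG' := hG.deriv hd Metric.isOpen_ball
  have hpt : ∀ z : 𝔻, Tendsto (fun m => f (ψ m) z) atTop (𝓝 (G z)) := fun z => by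
    simpa only [discExt_coe] using hG.tendsto_at (coe_mem_ball z)
  have hpt' : ∀ z : 𝔻, Tendsto (fun m => discDeriv (f (ψ m)) z) atTop (𝓝 (deriv G z)) :=
    fun z => hG'.tendsto_at (coe_mem_ball z)
  let g₀ : 𝔻 → ℂ := fun z => G z
  have hg₀ : ∀ z, discDeriv g₀ z = deriv G z := discDeriv_of_eq fun _ => rfl
  -- Keeping the value at `0` and the density together lets the limit stay in the closed unit ball.
  have hbound : ∀ z, ‖g₀ 0‖ + blochDensity g₀ z ≤ 1 := fun z => by
    rw [blochDensity, hg₀]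
    exact le_of_tendsto ((hpt 0).norm.add ((hpt' z).norm.const_mul (1 - ‖(z : ℂ)‖ ^ 2)))
      (Eventually.of_forall fun m =>
        ((f (ψ m)).norm_eval_zero_add_blochDensity_le z).trans (hf _))
  have hgB : IsBloch g₀ := by
    refine ⟨analyticOnDisc_of_eq (fun _ => rfl) hGd, 1, ?_⟩
    rintro _ ⟨z, rfl⟩
    linarith [hbound z, norm_nonneg (g₀ 0)]
  have hg1 : ‖mk g₀ hgB‖ ≤ 1 := by
    have := norm_le_of_forall (f := mk g₀ hgB) (A := ‖g₀ 0‖) (B := 1 - ‖g₀ 0‖) le_rfl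
      fun z => le_sub_iff_add_le'.2 (hbound z)
    simpa using this
  refine ⟨ψ, mk g₀ hgB, hψ, hg1, hpt, fun η hη => ?_⟩
  -- Outside radius `1 - η / 4` the extra factor `1 - |z|²` is at most `η / 2`, and the difference
  -- has norm at most `2`.
  have hunif := (tendstoLocallyUniformlyOn_iff_forall_isCompact Metric.isOpen_ball).1 hG'
    (Metric.closedBall 0 (1 - η / 4)) (Metric.closedBall_subset_ball (by linarith))
    (isCompact_closedBall _ _)
  filter_upwards [Metric.tendstoUniformlyOn_iff.1 hunif η hη] with m hm z hz
  have hz2 : 0 ≤ 1 - ‖z‖ ^ 2 := by nlinarith [norm_nonneg z]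
  by_cases hzR : ‖z‖ ≤ 1 - η / 4
  · have h1 := hm z (mem_closedBall_zero_iff.2 hzR)
    have e : deriv (discExt (f (ψ m) - mk g₀ hgB)) z = deriv (discExt (f (ψ m))) z - deriv G z := by
      have := map_sub (derivₗ (Complex.UnitDisc.mk z hz)) (f (ψ m)) (mk g₀ hgB)
      simp only [derivₗ_apply] at this
      refine this.trans ?_
      have h2 := hg₀ (Complex.UnitDisc.mk z hz)
      rw [Complex.UnitDisc.coe_mk] at h2
      exact congrArg₂ _ rfl h2
    rw [dist_comm, dist_eq_norm] at h1
    rw [e]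
    have h3 : (1 - ‖z‖ ^ 2) ^ 2 ≤ 1 := pow_le_one₀ hz2 (by nlinarith [norm_nonneg z])
    exact (mul_le_of_le_one_left (norm_nonneg _) h3).trans h1.le
  · rw [not_le] at hzR
    have h1 := (f (ψ m) - mk g₀ hgB).weighted_norm_deriv_le hz
    have h2 : ‖f (ψ m) - mk g₀ hgB‖ ≤ 2 :=
      (norm_sub_le _ _).trans (by linarith [hf (ψ m)])
    have h3 : 1 - ‖z‖ ^ 2 ≤ η / 2 := by nlinarith [norm_nonneg z]
    calc (1 - ‖z‖ ^ 2) ^ 2 * ‖deriv (discExt (f (ψ m) - mk g₀ hgB)) z‖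
        = (1 - ‖z‖ ^ 2) * ((1 - ‖z‖ ^ 2) * ‖deriv (discExt (f (ψ m) - mk g₀ hgB)) z‖) := by ring
      _ ≤ η / 2 * 2 := mul_le_mul h3 (h1.trans h2) (mul_nonneg hz2 (norm_nonneg _)) (by linarith)
      _ = η := by ring

end BlochSpace

open BlochSpace

/-! ### Compactness and the images of monomials. -/

section LinearCombination

variable {k : ℕ} (lam : Fin k → ℂ) {φ : Fin k → 𝔻 → 𝔻} (hφ : ∀ i, IsAnalyticSelfMap (φ i))

/-- The linear combination `∑ i, λ_i C_{φ_i}` of composition operators. -/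
noncomputable def compositionCombination : BlochSpace →ₗ[ℂ] BlochSpace :=
  ∑ i, lam i • compositionOperator (φ i) (hφ i)

theorem compositionCombination_apply (f : BlochSpace) :
    compositionCombination lam hφ f = ∑ i, lam i • compositionOperator (φ i) (hφ i) f := by
  simp [compositionCombination, LinearMap.sum_apply]

theorem compositionCombination_monomial (n : ℕ) :
    compositionCombination lam hφ (monomial n) = ∑ i, lam i • selfMapPow (φ i) (hφ i) n :=
  compositionCombination_apply lam hφ _

theorem compositionCombination_eval (f : BlochSpace) (z : 𝔻) :
    (compositionCombination lam hφ f) z = ∑ i, lam i * f (φ i z) := by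
  rw [← evalₗ_apply, compositionCombination_apply, map_sum]
  refine Finset.sum_congr rfl fun i _ => ?_
  rw [map_smul]
  rfl

theorem discDeriv_compositionCombination (f : BlochSpace) (z : 𝔻) :
    discDeriv (compositionCombination lam hφ f) z =
      ∑ i, lam i * discDeriv (fun z => (φ i z : ℂ)) z * discDeriv f (φ i z) := by
  rw [← derivₗ_apply, compositionCombination_apply, map_sum]
  refine Finset.sum_congr rfl fun i _ => ?_
  have h := (hφ i).discDeriv_comp f.isBloch.1 z
  rw [map_smul, smul_eq_mul, mul_assoc, mul_comm (discDeriv _ z)]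
  exact congrArg _ h

theorem blochDensity_compositionCombination (f : BlochSpace) (z : 𝔻) :
    blochDensity (compositionCombination lam hφ f) z =
      ‖∑ i, ((1 - ‖(z : ℂ)‖ ^ 2 : ℝ) * lam i * discDeriv (fun z => (φ i z : ℂ)) z) *
        deriv (discExt f) (φ i z)‖ := by
  have h : ‖((1 - ‖(z : ℂ)‖ ^ 2 : ℝ) : ℂ)‖ = 1 - ‖(z : ℂ)‖ ^ 2 := by
    rw [Complex.norm_real, Real.norm_of_nonneg (one_sub_norm_sq_pos z).le]
  rw [blochDensity, discDeriv_compositionCombination, ← h, ← norm_mul, Finset.mul_sum, h]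
  congr 1
  refine Finset.sum_congr rfl fun i _ => ?_
  rw [discDeriv]
  ring_nf
  rfl

/-- Apply `exists_sum_eval_bound` at each `z` to the derivative of `f`; its constant does not see
the points or weights, so the supremum over `z` is harmless. -/
theorem exists_norm_compositionCombination_le : ∃ C : ℝ, 0 ≤ C ∧ ∀ (E e : ℝ) (N : ℕ),
    (∀ n, ‖compositionCombination lam hφ (monomial n)‖ ≤ E) →
    (∀ n ≥ N, ‖compositionCombination lam hφ (monomial n)‖ ≤ e) →
    ∀ (f : BlochSpace) (η : ℝ),
      (∀ z : ℂ, ‖z‖ < 1 → (1 - ‖z‖ ^ 2) ^ 2 * ‖deriv (discExt f) z‖ ≤ η) →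
      ‖compositionCombination lam hφ f‖ ≤
        ‖(compositionCombination lam hφ f) 0‖ + C * (N * E * η + e * ‖f‖) := by
  obtain ⟨C, hC0, hC⟩ := exists_sum_eval_bound k
  refine ⟨C, hC0, fun E e N hE he f η hη => norm_le_of_forall le_rfl fun z => ?_⟩
  rw [blochDensity_compositionCombination]
  -- The degree shifts by one because the derivative of `z ^ (n + 1)` is `(n + 1) z ^ n`.
  have hmon : ∀ n : ℕ, (n + 1) * ‖∑ i, ((1 - ‖(z : ℂ)‖ ^ 2 : ℝ) * lam i *
      discDeriv (fun z => (φ i z : ℂ)) z) * (φ i z : ℂ) ^ n‖ ≤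
      ‖compositionCombination lam hφ (monomial (n + 1))‖ := fun n => by
    refine le_trans (le_of_eq ?_) (blochDensity_le_norm _ z)
    rw [blochDensity_compositionCombination]
    have e1 : ((n : ℝ) + 1) = ‖((n + 1 : ℕ) : ℂ)‖ := by
      rw [Complex.norm_natCast]
      push_cast
      rfl
    rw [e1, ← norm_mul, Finset.mul_sum]
    congr 1
    refine Finset.sum_congr rfl fun i _ => ?_
    have e2 : deriv (discExt (monomial (n + 1))) (φ i z) = (n + 1 : ℕ) * (φ i z : ℂ) ^ n := by
      have := discDeriv_of_eq (f := monomial (n + 1)) (g := fun z => z ^ (n + 1))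
        (fun _ => rfl) (φ i z)
      rw [deriv_pow_field] at this
      exact this
    rw [e2]
    ring
  exact hC _ (fun i => φ i z) (fun i => (φ i z).norm_lt_one) E e N
    (fun n => (hmon n).trans (hE _)) (fun n hn => (hmon n).trans (he _ (Nat.le_succ_of_le hn)))
    (deriv (discExt f)) ‖f‖ η f.differentiableOn_deriv
    (fun z hz => f.weighted_norm_deriv_le hz) hη

theorem isCompactOperator_compositionCombination
    (h : Tendsto (fun n => ‖compositionCombination lam hφ (monomial n)‖) atTop (𝓝 0)) :
    IsCompactOperator (compositionCombination lam hφ) := by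
  obtain ⟨C, hC0, hC⟩ := exists_norm_compositionCombination_le lam hφ
  obtain ⟨E, hE⟩ := h.bddAbove_range
  replace hE : ∀ n, ‖compositionCombination lam hφ (monomial n)‖ ≤ E := fun n => hE ⟨n, rfl⟩
  have hE0 : 0 ≤ E := (norm_nonneg _).trans (hE 0)
  rw [isCompactOperator_iff_exists_mem_nhds_image_subset_compact]
  -- The image of the closed unit ball is itself compact, since the limits `g` remain in that ball.
  refine ⟨Metric.closedBall 0 1, Metric.closedBall_mem_nhds _ one_pos, _, ?_, subset_rfl⟩
  refine IsSeqCompact.isCompact fun x hx => ?_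
  choose f hf hfx using hx
  obtain ⟨ψ, g, hψ, hg1, hpt, hη⟩ := exists_subseq_tendsto_of_norm_le_one
    (f := f) fun m => mem_closedBall_zero_iff.1 (hf m)
  refine ⟨_, ⟨g, mem_closedBall_zero_iff.2 hg1, rfl⟩, ψ, hψ, ?_⟩
  have hval : Tendsto (fun m => ‖(compositionCombination lam hφ (f (ψ m) - g)) 0‖) atTop (𝓝 0) := by
    have h1 : Tendsto (fun m => ∑ i, lam i * (f (ψ m) (φ i 0) - g (φ i 0))) atTop
        (𝓝 (∑ i, lam i * (g (φ i 0) - g (φ i 0)))) :=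
      tendsto_finsetSum _ fun i _ => ((hpt _).sub_const _).const_mul _
    have h2 := h1.norm
    simp only [sub_self, mul_zero, Finset.sum_const_zero, norm_zero] at h2
    refine h2.congr fun m => ?_
    rw [compositionCombination_eval]
    rfl
  rw [Metric.tendsto_nhds]
  intro ε hε
  -- The order matters: `e` determines `N`, and `η` is chosen afterwards to beat `N * E`. Each of
  -- the three error terms is at most `ε / 3`.
  set e : ℝ := ε / (6 * (C + 1)) with he
  have he0 : 0 < e := by positivity
  obtain ⟨N, hN⟩ := eventually_atTop.1 (h.eventually_le_const he0)
  set η : ℝ := ε / (3 * (C * (N * E) + 1)) with hηdef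
  have hη0 : 0 < η := by positivity
  filter_upwards [hη η hη0, hval.eventually_lt_const (show 0 < ε / 3 by positivity)] with m hm hm0
  have h1 := hC E e N hE hN (f (ψ m) - g) η hm
  have h2 : ‖f (ψ m) - g‖ ≤ 2 := (norm_sub_le _ _).trans (by
    linarith [mem_closedBall_zero_iff.1 (hf (ψ m))])
  have h3 : C * (N * E) * η ≤ ε / 3 := by
    rw [hηdef, ← mul_div_assoc, div_le_iff₀ (by positivity)]
    linarith
  have h4 : C * (e * ‖f (ψ m) - g‖) ≤ ε / 3 := by
    calc C * (e * ‖f (ψ m) - g‖) ≤ C * (e * 2) := by gcongr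
      _ = C * ε / (3 * (C + 1)) := by rw [he]; field_simp; ring
      _ ≤ ε / 3 := by
        rw [div_le_iff₀ (by positivity)]
        linarith
  rw [dist_eq_norm, Function.comp_apply, ← hfx, ← map_sub]
  linarith

theorem tendsto_norm_compositionCombination_monomial
    (h : IsCompactOperator (compositionCombination lam hφ)) :
    Tendsto (fun n => ‖compositionCombination lam hφ (monomial n)‖) atTop (𝓝 0) := by
  obtain ⟨K, hK, hKi⟩ := h.image_closedBall_subset_compact (1 + 2)
  rw [← norm_zero (E := BlochSpace)]
  refine Tendsto.norm (hK.tendsto_nhds_of_unique_mapClusterPt (Eventually.of_forall fun n =>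
    hKi ⟨_, mem_closedBall_zero_iff.2 (norm_monomial_le n), rfl⟩) fun g _ hg => ?_)
  refine BlochSpace.ext fun z => ?_
  have h1 := hg.continuousAt_comp (continuous_eval z).continuousAt
  have h2 : Tendsto (fun n => (compositionCombination lam hφ (monomial n)) z) atTop (𝓝 0) := by
    have h3 : Tendsto (fun n => ∑ i, lam i * (φ i z : ℂ) ^ n) atTop (𝓝 (∑ i, lam i * 0)) :=
      tendsto_finsetSum _ fun i _ =>
        (tendsto_pow_atTop_nhds_zero_of_norm_lt_one (φ i z).norm_lt_one).const_mul _
    simp only [mul_zero, Finset.sum_const_zero] at h3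
    refine h3.congr fun n => ?_
    rw [compositionCombination_eval]
    rfl
  -- A cluster point of a sequence of values converging to `0` must be `0`.
  exact eq_of_nhds_neBot (h1.neBot.mono (inf_le_inf_left _ h2))

end LinearCombination

theorem theorem1 (k : ℕ) (hk : 0 < k) (lam : Fin k → ℂ) (hlam : ∀ i, lam i ≠ 0)
    (φ : Fin k → 𝔻 → 𝔻) (hφ : ∀ i, IsAnalyticSelfMap (φ i)) :
    IsCompactOperator
        ⇑(∑ i, lam i • compositionOperator (φ i) (hφ i) : BlochSpace →ₗ[ℂ] BlochSpace) ↔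
      Tendsto (fun n : ℕ => ‖∑ i, lam i • selfMapPow (φ i) (hφ i) n‖) atTop (𝓝 0) := by
  simp only [← compositionCombination_monomial]
  exact ⟨tendsto_norm_compositionCombination_monomial lam hφ,
    isCompactOperator_compositionCombination lam hφ⟩
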